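/- Let $\mathsf{Prop}$ be a set of propositional letters with at least three elements. Let $\mathcal L_0$ be the formulas built from letters by $\neg,\wedge$, and let $\mathcal L_1$ (the one-step formulas) be the formulas built by $\neg,\wedge$ from conditionals $\alpha\leadsto\beta$ with $\alpha,\beta\in\mathcal L_0$; the connectives $\vee,\rightarrow,\leftrightarrow$ are the usual abbreviations. Preferential conditional logic has as axioms all propositional tautologies in $\mathcal L_0$ and, for letters $p,q,r$, \[p\leadsto p,\qquad (p\leadsto q)\wedge(p\leadsto r)\rightarrow(p\leadsto q\wedge r),\] \[(p\leadsto q)\wedge(p\leadsto r)\rightarrow(p\wedge r\leadsto q),\qquad (p\leadsto q)\wedge(r\leadsto q)\rightarrow(p\vee r\leadsto q);\] its rules are modus ponens (within $\mathcal L_0$ or within $\mathcal L_1$), uniform substitution (of $\mathcal L_0$- or $\mathcal L_1$-formulas into $\mathcal L_0$-formulas, and of $\mathcal L_0$-formulas into $\mathcal L_1$-formulas), and the two rules: from $\varphi\leftrightarrow\chi$ infer $(\varphi\leadsto\psi)\leftrightarrow(\chi\leadsto\psi)$, and from $\psi\rightarrow\chi$ infer $(\varphi\leadsto\psi)\rightarrow(\varphi\leadsto\chi)$,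 for $\varphi,\psi,\chi\in\mathcal L_0$. A formula $\varphi\in\mathcal L_1$ is consistent if $\neg\varphi$ is not derivable. For a finite (possibly empty) set $W\subseteq\mathbb R^2$ let $\mathcal C=\{C'\cap W : C'\subseteq\mathbb R^2 \text{ convex}\}$ be its relative convexity, and let $V:\mathsf{Prop}\to\mathcal P(W)$ be a valuation, extended to $\mathcal L_0$ by $[\![p]\!]=V(p)$, $[\![\neg\alpha]\!]=W\setminus[\![\alpha]\!]$, $[\![\alpha\wedge\beta]\!]=[\![\alpha]\!]\cap[\![\beta]\!]$. In the model $(W,\mathcal C,V)$ a conditional $\alpha\leadsto\beta$ is true if and only if for every $C\in\mathcal C$ with $[\![\alpha]\!]\nsubseteq C$ there is $D\in\mathcal C$ with $C\subseteq D$, $[\![\alpha]\!]\nsubseteq D$ and $[\![\alpha]\!]\subseteq D\cup[\![\beta]\!]$; negation and conjunction are interpreted classically. Theorem. Every consistent formula $\varphi\in\mathcal L_1$ is true in some model $(W,\mathcal C,V)$ where $W\subseteq\mathbb R^2$ is a finite set of points and $\mathcal C$ is the relative convexity of $W$ in $\mathbb R^2$. Consequently, together with soundness, a formula of $\mathcal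 L_1$ is derivable in preferential conditional logic if and only if it is true in all such models. -/

import Mathlib

namespace PCL

universe u v

/-! ### Convex geometries -/

/-- A convex geometry on `W`: a family of subsets of `W`, the convex sets, closed under arbitrary
intersections (so `W` itself is convex) and with the anti-exchange property.
The empty set is not required to be convex. -/
structure ConvexGeometry (W : Type v) where
  IsConvex : Set W → Prop
  sInter_mem : ∀ X : Set (Set W), (∀ C ∈ X, IsConvex C) → IsConvex (⋂₀ X)
  antiExchange : ∀ C : Set W, IsConvex C → ∀ x y : W, x ∉ C → y ∉ C → x ≠ y →
    ∃ D : Set W, IsConvex D ∧ C ⊆ D ∧ ((x ∈ D ∧ y ∉ D) ∨ (x ∉ D ∧ y ∈ D))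

/-- The relative convexity on a subset `X` of a convex geometry: its convex sets are the
intersections with `X` of the convex sets of the whole space. -/
def ConvexGeometry.relative {W : Type v} (G : ConvexGeometry W) (X : Set W) :
    ConvexGeometry X where
  IsConvex C := ∃ C' : Set W, G.IsConvex C' ∧ C = {x : X | (x : W) ∈ C'}
  sInter_mem := by
    intro 𝒳 h
    refine ⟨⋂₀ {C' | G.IsConvex C' ∧ {x : X | (x : W) ∈ C'} ∈ 𝒳},
      G.sInter_mem _ fun C hC => hC.1, ?_⟩
    ext x
    constructor
    · intro hx C' hC'
      exact hx _ hC'.2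
    · intro hx C hC
      obtain ⟨C', hC', rfl⟩ := h C hC
      exact hx C' ⟨hC', hC⟩
  antiExchange := by
    rintro C ⟨C', hC', rfl⟩ x y hx hy hxy
    obtain ⟨D, hD, hCD, h⟩ :=
      G.antiExchange C' hC' x y hx hy (fun e => hxy (Subtype.ext e))
    exact ⟨{z : X | (z : W) ∈ D}, ⟨D, hD, rfl⟩, fun z hz => hCD hz, h⟩

/-- The anti-exchange property of the convex sets of a real vector space. -/
theorem convex_antiExchange {E : Type*} [AddCommGroup E] [Module ℝ E] (C : Set E)
    (hC : Convex ℝ C) (x y : E) (hx : x ∉ C) (hy : y ∉ C) (hxy : x ≠ y) :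
    ∃ D : Set E, Convex ℝ D ∧ C ⊆ D ∧ ((x ∈ D ∧ y ∉ D) ∨ (x ∉ D ∧ y ∈ D)) := by
  rcases C.eq_empty_or_nonempty with rfl | hne
  · exact ⟨{x}, convex_singleton x, Set.empty_subset _, Or.inl ⟨rfl, fun h => hxy h.symm⟩⟩
  by_contra! hcon
  have key : ∀ z : E, C ⊆ convexHull ℝ (insert z C) ∧ z ∈ convexHull ℝ (insert z C) := fun z =>
    ⟨(Set.subset_insert z C).trans (subset_convexHull ℝ _),
      subset_convexHull ℝ _ (Set.mem_insert z C)⟩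
  have h1 := (hcon _ (convex_convexHull ℝ _) (key x).1).1 (key x).2
  have h2 : x ∈ convexHull ℝ (insert y C) := by
    by_contra hn
    exact (hcon _ (convex_convexHull ℝ _) (key y).1).2 hn (key y).2
  rw [convexHull_insert hne, hC.convexHull_eq, mem_convexJoin] at h1 h2
  obtain ⟨x₀, hx₀, c, hc, a, a', ha, ha', haa, hya⟩ := h1
  obtain ⟨y₀, hy₀, d, hd, b, b', hb, hb', hbb, hxb⟩ := h2
  rw [Set.mem_singleton_iff.mp hx₀] at hya
  rw [Set.mem_singleton_iff.mp hy₀] at hxb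
  -- `y = a x + a' c` and `x = b y + b' d`
  have ha1 : a ≤ 1 := by linarith
  have hb1 : b ≤ 1 := by linarith
  by_cases hab : a * b = 1
  · have h1 : a = 1 := by nlinarith
    have h0 : a' = 0 := by linarith
    subst h1
    subst h0
    apply hxy
    simpa using hya
  · have hlt : 0 < 1 - a * b := by
      have : a * b ≤ 1 := by nlinarith
      rcases lt_or_eq_of_le this with h | h
      · linarith
      · exact absurd h hab
    apply hx
    have hsum : (1 - a * b) • x = (b * a') • c + b' • d := by
      have e : x = b • (a • x + a' • c) + b' • d := by rw [hya]; exact hxb.symm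
      calc (1 - a * b) • x = x - (a * b) • x := by rw [sub_smul, one_smul]
        _ = (b • (a • x + a' • c) + b' • d) - (a * b) • x := by rw [← e]
        _ = (b * a') • c + b' • d := by module
    have hx' : x = ((1 - a * b)⁻¹ * (b * a')) • c + ((1 - a * b)⁻¹ * b') • d := by
      rw [mul_smul _ (b * a'), mul_smul _ b', ← smul_add, ← hsum, smul_smul, inv_mul_cancel₀ hlt.ne', one_smul]
    rw [hx']
    refine hC hc hd (by positivity) (by positivity) ?_
    rw [← mul_add]
    have : b * a' + b' = 1 - a * b := by
      have : a' = 1 - a := by linarith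
      subst this
      linarith
    rw [this, inv_mul_cancel₀ hlt.ne']

/-- The Euclidean plane. -/
abbrev Plane : Type := EuclideanSpace ℝ (Fin 2)

/-- The standard convexity of the plane. -/
def standardConvexity : ConvexGeometry Plane where
  IsConvex C := Convex ℝ C
  sInter_mem _ h := convex_sInter h
  antiExchange := convex_antiExchange

/-! ### Syntax -/

/-- Formulas of classical propositional logic over the letters `P`. -/
inductive Form0 (P : Type u) : Type u where
  | atom : P → Form0 P
  | neg : Form0 P → Form0 P
  | and : Form0 P → Form0 P → Form0 P

/-- One-step formulas: Boolean combinations of conditionals between propositional formulas. -/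
inductive Form1 (P : Type u) : Type u where
  | cond : Form0 P → Form0 P → Form1 P
  | neg : Form1 P → Form1 P
  | and : Form1 P → Form1 P → Form1 P

variable {P : Type u}

def Form0.or (φ ψ : Form0 P) : Form0 P := .neg (.and (.neg φ) (.neg ψ))
def Form0.imp (φ ψ : Form0 P) : Form0 P := .neg (.and φ (.neg ψ))
def Form0.iff (φ ψ : Form0 P) : Form0 P := .and (φ.imp ψ) (ψ.imp φ)

def Form1.imp (φ ψ : Form1 P) : Form1 P := .neg (.and φ (.neg ψ))
def Form1.iff (φ ψ : Form1 P) : Form1 P := .and (φ.imp ψ) (ψ.imp φ)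

/-- Uniform substitution of propositional formulas into a propositional formula. -/
def Form0.subst (σ : P → Form0 P) : Form0 P → Form0 P
  | .atom p => σ p
  | .neg φ => .neg (φ.subst σ)
  | .and φ ψ => .and (φ.subst σ) (ψ.subst σ)

/-- Uniform substitution of one-step formulas into a propositional formula. -/
def Form0.subst1 (σ : P → Form1 P) : Form0 P → Form1 P
  | .atom p => σ p
  | .neg φ => .neg (φ.subst1 σ)
  | .and φ ψ => .and (φ.subst1 σ) (ψ.subst1 σ)

/-- Uniform substitution of propositional formulas into a one-step formula. -/
def Form1.subst (σ : P → Form0 P) : Form1 P → Form1 P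
  | .cond φ ψ => .cond (φ.subst σ) (ψ.subst σ)
  | .neg φ => .neg (φ.subst σ)
  | .and φ ψ => .and (φ.subst σ) (ψ.subst σ)

/-- The extension `⟦φ⟧_V` of a propositional formula under a valuation `V`. -/
def Form0.ext {W : Type v} (V : P → Set W) : Form0 P → Set W
  | .atom p => V p
  | .neg φ => (φ.ext V)ᶜ
  | .and φ ψ => φ.ext V ∩ ψ.ext V

/-- Truth of a propositional formula under a truth assignment. -/
def Form0.eval (a : P → Prop) : Form0 P → Prop
  | .atom p => a p
  | .neg φ => ¬ φ.eval a
  | .and φ ψ => φ.eval a ∧ ψ.eval a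

def Form0.Tautology (φ : Form0 P) : Prop := ∀ a : P → Prop, φ.eval a

/-! ### The axiomatic system -/

/-- Derivability of propositional formulas. -/
inductive Derivable0 : Form0 P → Prop where
  | taut {φ : Form0 P} : φ.Tautology → Derivable0 φ
  | mp {φ ψ : Form0 P} : Derivable0 (φ.imp ψ) → Derivable0 φ → Derivable0 ψ
  | subst {φ : Form0 P} (σ : P → Form0 P) : Derivable0 φ → Derivable0 (φ.subst σ)

open Form0 in
/-- Derivability of one-step formulas in preferential conditional logic. The four axioms are
formulated for propositional letters; their instances come from uniform substitution. -/
inductive Derivable1 : Form1 P → Prop where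
  | id (p : P) : Derivable1 (.cond (atom p) (atom p))
  | and (p q r : P) : Derivable1
      (.imp (.and (.cond (atom p) (atom q)) (.cond (atom p) (atom r)))
        (.cond (atom p) ((atom q).and (atom r))))
  | cm (p q r : P) : Derivable1
      (.imp (.and (.cond (atom p) (atom q)) (.cond (atom p) (atom r)))
        (.cond ((atom p).and (atom r)) (atom q)))
  | or (p q r : P) : Derivable1
      (.imp (.and (.cond (atom p) (atom q)) (.cond (atom r) (atom q)))
        (.cond ((atom p).or (atom r)) (atom q)))
  | mp {φ ψ : Form1 P} : Derivable1 (φ.imp ψ) → Derivable1 φ → Derivable1 ψ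
  | subst0 {φ : Form0 P} (σ : P → Form1 P) : Derivable0 φ → Derivable1 (φ.subst1 σ)
  | subst {φ : Form1 P} (σ : P → Form0 P) : Derivable1 φ → Derivable1 (φ.subst σ)
  | lle {φ χ : Form0 P} (ψ : Form0 P) : Derivable0 (φ.iff χ) →
      Derivable1 ((Form1.cond φ ψ).iff (.cond χ ψ))
  | rw {ψ χ : Form0 P} (φ : Form0 P) : Derivable0 (ψ.imp χ) →
      Derivable1 ((Form1.cond φ ψ).imp (.cond φ χ))

/-- A one-step formula is consistent if its negation is not derivable. -/
def Consistent (φ : Form1 P) : Prop := ¬ Derivable1 (.neg φ)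

/-! ### Semantics -/

/-- A model `(W, 𝒞, V)`: a set of worlds, a convex geometry on it and a valuation. -/
structure Model (P : Type u) where
  World : Type v
  geometry : ConvexGeometry World
  val : P → Set World

/-- Truth of a one-step formula in a model. -/
def Model.Satisfies (M : Model.{u, v} P) : Form1 P → Prop
  | .cond φ ψ => ∀ C, M.geometry.IsConvex C → ¬ φ.ext M.val ⊆ C →
      ∃ D, M.geometry.IsConvex D ∧ C ⊆ D ∧ ¬ φ.ext M.val ⊆ D ∧ φ.ext M.val ⊆ D ∪ ψ.ext M.val
  | .neg φ => ¬ M.Satisfies φ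
  | .and φ ψ => M.Satisfies φ ∧ M.Satisfies ψ

/-- The model on a set `W` of points of the plane with the relative convexity of `W`. -/
def planeModel (W : Set Plane) (V : P → Set W) : Model P where
  World := W
  geometry := standardConvexity.relative W
  val := V

end PCL

/-!
A preferential consequence relation on a finite set `X` has the form `f A ⊆ B` for a path
independent choice function `f`, and in a finite convex geometry the conditional is of this form,
with `f` sending a set to its extreme points. So, after a Lindenbaum argument and passing to truth
assignments to the finitely many letters of a formula, everything comes down to realizing a path
independent `f` by extreme points of labelled points of the plane.

Such an `f` collects the maximizers of finitely many rankings of `X`. To each ranking assign a line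
through the origin, and put a copy of each `x` on both of its rays, just outside the unit circle and
the farther out the higher `x` is ranked. On a single line only the copies of the best element of
`A` can be extreme among the copies of `A`, since the others lie between them; and these are indeed
extreme, because the line orthogonal to the spoke at this copy separates it from all other spokes,
which stay close to the unit circle.
-/

namespace PCL

universe u v

/-! ### Preferential consequence and convex geometries -/

/-- Preferential consequence relations between subsets of `X`, in the sense of Kraus, Lehmann and
Magidor: `N A B` says that, normally, elements of `A` are in `B`. The fields are the set versions of
the axioms and rules of preferential conditional logic. -/
structure IsPreferential {X : Type*} (N : Set X → Set X → Prop) : Prop where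
  refl : ∀ A, N A A
  mono_right : ∀ {A B C}, N A B → B ⊆ C → N A C
  inter : ∀ {A B C}, N A B → N A C → N A (B ∩ C)
  cautious_mono : ∀ {A B C}, N A B → N A C → N (A ∩ C) B
  union : ∀ {A B C}, N A B → N C B → N (A ∪ C) B

namespace ConvexGeometry

variable {W : Type*} (G : ConvexGeometry W)

/-- The truth condition of the conditional in the convex geometry `G`, as a relation between the
extensions of its antecedent and its consequent. -/
def Entails (A B : Set W) : Prop :=
  ∀ C, G.IsConvex C → ¬ A ⊆ C → ∃ D, G.IsConvex D ∧ C ⊆ D ∧ ¬ A ⊆ D ∧ A ⊆ D ∪ B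

theorem isPreferential_entails : IsPreferential G.Entails where
  refl A C hC hAC := ⟨C, hC, subset_rfl, hAC, Set.subset_union_right⟩
  mono_right hAB hBC C hC hAC := by
    obtain ⟨D, hD, hCD, hAD, hADB⟩ := hAB C hC hAC
    exact ⟨D, hD, hCD, hAD, hADB.trans (Set.union_subset_union_right D hBC)⟩
  inter hAB₁ hAB₂ C hC hAC := by
    obtain ⟨D, hD, hCD, hAD, hADB₁⟩ := hAB₁ C hC hAC
    obtain ⟨E, hE, hDE, hAE, hAEB₂⟩ := hAB₂ D hD hAD
    refine ⟨E, hE, hCD.trans hDE, hAE, ?_⟩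
    rw [Set.union_inter_distrib_left]
    exact Set.subset_inter (hADB₁.trans (Set.union_subset_union_left _ hDE)) hAEB₂
  cautious_mono {A B A'} hAB hAA' C hC hC' := by
    obtain ⟨D, hD, hCD, hAD, hADB⟩ := hAB C hC fun h => hC' (Set.inter_subset_left.trans h)
    obtain ⟨E, hE, hDE, hAE, hAEA'⟩ := hAA' D hD hAD
    refine ⟨E, hE, hCD.trans hDE, fun h => hAE fun x hx => ?_, fun x hx => ?_⟩
    · exact (hAEA' hx).elim id fun hxA' => h ⟨hx, hxA'⟩
    · exact (hADB hx.1).imp_left fun hxD => hDE hxD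
  union {A₁ B A₂} h₁ h₂ C hC hAC := by
    by_cases hA₁ : A₁ ⊆ C
    · obtain ⟨D, hD, hCD, hAD, hADB⟩ := h₂ C hC fun hA₂ => hAC (Set.union_subset hA₁ hA₂)
      exact ⟨D, hD, hCD, fun h => hAD (Set.subset_union_right.trans h),
        Set.union_subset ((hA₁.trans hCD).trans Set.subset_union_left) hADB⟩
    obtain ⟨D, hD, hCD, hAD, hADB⟩ := h₁ C hC hA₁
    by_cases hA₂ : A₂ ⊆ D
    · exact ⟨D, hD, hCD, fun h => hAD (Set.subset_union_left.trans h),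
        Set.union_subset hADB (hA₂.trans Set.subset_union_left)⟩
    · obtain ⟨E, hE, hDE, hAE, hAEB⟩ := h₂ D hD hA₂
      exact ⟨E, hE, hCD.trans hDE, fun h => hAE (Set.subset_union_right.trans h),
        Set.union_subset (hADB.trans (Set.union_subset_union_left B hDE)) hAEB⟩

/-- The points of `S` that a convex set separates from the rest of `S`. -/
def extremePoints (S : Set W) : Set W :=
  {x | x ∈ S ∧ ∃ D, G.IsConvex D ∧ S \ {x} ⊆ D ∧ x ∉ D}

/-- Anti-exchange makes a maximal convex set that does not contain `S` miss only one point. -/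
theorem exists_extremePoint_of_not_subset [Finite W] {S C : Set W} (hC : G.IsConvex C)
    (hSC : ¬ S ⊆ C) :
    ∃ x ∈ G.extremePoints S, ∃ D, G.IsConvex D ∧ C ⊆ D ∧ x ∉ D ∧ S ⊆ D ∪ {x} := by
  obtain ⟨D, hCD, ⟨hD, hSD⟩, hmax⟩ :=
    (Set.toFinite {D | G.IsConvex D ∧ ¬ S ⊆ D}).exists_le_maximal ⟨hC, hSC⟩
  obtain ⟨x, hxS, hxD⟩ := Set.not_subset.1 hSD
  have heq : ∀ y ∈ S, y ∉ D → y = x := by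
    intro y hyS hyD
    by_contra hyx
    obtain ⟨E, hE, hDE, ⟨hyE, hxE⟩ | ⟨hyE, hxE⟩⟩ := G.antiExchange D hD y x hyD hxD hyx
    · exact hyD (hmax ⟨hE, fun h => hxE (h hxS)⟩ hDE hyE)
    · exact hxD (hmax ⟨hE, fun h => hyE (h hyS)⟩ hDE hxE)
  have hSDx : S ⊆ D ∪ {x} := fun y hy => or_iff_not_imp_left.2 (heq y hy)
  exact ⟨x, ⟨hxS, D, hD, Set.sdiff_subset_iff.2 (Set.union_comm D {x} ▸ hSDx), hxD⟩,
    D, hD, hCD, hxD, hSDx⟩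

theorem entails_iff_extremePoints_subset [Finite W] {A B : Set W} :
    G.Entails A B ↔ G.extremePoints A ⊆ B := by
  constructor
  · rintro hAB x ⟨hxA, D, hD, hAD, hxD⟩
    obtain ⟨E, -, hDE, hAE, hAEB⟩ := hAB D hD fun h => hxD (h hxA)
    refine (hAEB hxA).resolve_left fun hxE => hAE ?_
    rw [← Set.insert_eq_of_mem hxE, ← Set.sdiff_singleton_subset_iff]
    exact hAD.trans hDE
  · intro hAB C hC hAC
    obtain ⟨x, hx, D, hD, hCD, hxD, hADx⟩ := G.exists_extremePoint_of_not_subset hC hAC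
    exact ⟨D, hD, hCD, fun h => hxD (h hx.1),
      hADx.trans (Set.union_subset_union_right D (Set.singleton_subset_iff.2 (hAB hx)))⟩

end ConvexGeometry

/-! ### Path independent choice functions -/

/-- Choice functions with Sen's heritage property and the outcast property; together these amount
to Plott's path independence `f (A ∪ B) = f (f A ∪ f B)`. Nonempty sets may have an empty choice. -/
structure PathIndependent {X : Type*} (f : Set X → Set X) : Prop where
  subset : ∀ A, f A ⊆ A
  heritage : ∀ {A B x}, A ⊆ B → x ∈ f B → x ∈ A → x ∈ f A
  outcast : ∀ {A B}, f B ⊆ A → A ⊆ B → f A ⊆ f B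

/-- The choice function of a consequence relation: an element of `A` is chosen if being different
from it is not a consequence of `A`. -/
def choice {X : Type*} (N : Set X → Set X → Prop) (A : Set X) : Set X := {x | ¬ N A {x}ᶜ}

namespace IsPreferential

variable {X : Type*} {N : Set X → Set X → Prop}

theorem of_subset (hN : IsPreferential N) {A B : Set X} (h : A ⊆ B) : N A B :=
  hN.mono_right (hN.refl A) h

theorem iff_choice_subset [Finite X] (hN : IsPreferential N) {A B : Set X} :
    N A B ↔ choice N A ⊆ B := by
  constructor
  · intro hAB x hx
    by_contra hxB
    exact hx (hN.mono_right hAB (Set.subset_compl_singleton_iff.2 hxB))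
  · suffices h : ∀ C : Set X, (∀ x ∈ C, N A {x}ᶜ) → N A Cᶜ from fun hB =>
      compl_compl B ▸ h Bᶜ fun x hx => not_not.1 fun hxA => hx (hB hxA)
    intro C
    induction C, C.toFinite using Set.Finite.induction_on with
    | empty => exact fun _ => hN.of_subset (Set.compl_empty ▸ Set.subset_univ A)
    | @insert x C _ _ ih =>
      intro hC
      rw [Set.insert_eq, Set.compl_union]
      exact hN.inter (hC x (Set.mem_insert x C)) (ih fun y hy => hC y (Set.mem_insert_of_mem x hy))

theorem pathIndependent_choice [Finite X] (hN : IsPreferential N) :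
    PathIndependent (choice N) where
  subset A := hN.iff_choice_subset.1 (hN.refl A)
  heritage {A B x} hAB hxB hxA hAx := by
    have hBA : N (B \ A) {x}ᶜ :=
      hN.of_subset (Set.subset_compl_singleton_iff.2 fun h => h.2 hxA)
    exact hxB (Set.union_sdiff_cancel hAB ▸ hN.union hAx hBA)
  outcast {A B} hBA hAB := by
    have := hN.cautious_mono (hN.iff_choice_subset.2 subset_rfl) (hN.iff_choice_subset.2 hBA)
    rw [Set.inter_eq_self_of_subset_right hAB] at this
    exact hN.iff_choice_subset.1 this

end IsPreferential

/-- An injective ranking of `Y` in which each element is chosen from the set of those ranked no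
higher. By heritage it is then chosen from every set in which it is ranked highest. -/
structure IsRanking {X : Type*} (f : Set X → Set X) (Y : Set X) (r : X → ℕ) : Prop where
  injOn : Set.InjOn r Y
  mem_choice : ∀ x ∈ Y, x ∈ f {y ∈ Y | r y ≤ r x}

section Rankings

variable {X : Type*} {f : Set X → Set X} {Y : Set X}

theorem isRanking_empty (f : Set X → Set X) (r : X → ℕ) : IsRanking f ∅ r :=
  ⟨Set.injOn_empty r, fun _ hx => hx.elim⟩

theorem IsRanking.extend {x : X} {r : X → ℕ} (hr : IsRanking f (Y \ {x}) r) (hx : x ∈ f Y)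
    (hlt : ∀ y ∈ Y \ {x}, r y < r x) : IsRanking f Y r := by
  have hle : ∀ y ∈ Y, r y ≤ r x := fun y hy => by
    rcases eq_or_ne y x with rfl | hyx
    · exact le_rfl
    · exact (hlt y ⟨hy, hyx⟩).le
  refine ⟨?_, fun z hz => ?_⟩
  · refine ((Set.injOn_insert fun h => h.2 rfl).2 ⟨hr.injOn, ?_⟩).mono
      (Set.sdiff_singleton_subset_iff.1 subset_rfl)
    rintro ⟨y, hy, hyx⟩
    exact (hlt y hy).ne hyx
  · rcases eq_or_ne z x with rfl | hzx
    · rwa [Set.sep_eq_self_iff_mem_true.2 hle]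
    · have hsep : {y ∈ Y | r y ≤ r z} = {y ∈ Y \ {x} | r y ≤ r z} := by
        ext y
        refine ⟨fun hy => ⟨⟨hy.1, ?_⟩, hy.2⟩, fun hy => ⟨hy.1.1, hy.2⟩⟩
        rintro rfl
        exact (hlt z ⟨hz, hzx⟩).not_ge hy.2
      exact hsep ▸ hr.mem_choice z ⟨hz, hzx⟩

theorem IsRanking.congr {r r' : X → ℕ} (hr : IsRanking f Y r) (h : Set.EqOn r r' Y) :
    IsRanking f Y r' := by
  refine ⟨hr.injOn.congr h, fun x hx => ?_⟩
  have hsep : {y ∈ Y | r' y ≤ r' x} = {y ∈ Y | r y ≤ r x} :=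
    Set.sep_ext_iff.2 fun y hy => by rw [h hx, h hy]
  exact hsep ▸ hr.mem_choice x hx

theorem IsRanking.exists_extend [Finite X] {x : X} {r : X → ℕ} (hr : IsRanking f (Y \ {x}) r)
    (hx : x ∈ f Y) :
    ∃ r', IsRanking f Y r' ∧ Set.EqOn r r' (Y \ {x}) ∧ ∀ y ∈ Y \ {x}, r' y < r' x := by
  classical
  obtain ⟨N, hN⟩ := (Set.finite_range r).bddAbove
  have heq : Set.EqOn r (Function.update r x (N + 1)) (Y \ {x}) :=
    fun y hy => (Function.update_of_ne hy.2 _ r).symm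
  have hlt : ∀ y ∈ Y \ {x}, Function.update r x (N + 1) y < Function.update r x (N + 1) x := by
    intro y hy
    rw [← heq hy, Function.update_self]
    exact Nat.lt_succ_of_le (hN ⟨y, rfl⟩)
  exact ⟨_, (hr.congr heq).extend hx hlt, heq, hlt⟩

/-- Rank the elements of `Y` from the top, each time removing one chosen from what is left, and
prefer elements outside `A` as long as there are any; by outcast `b` comes right after these. -/
theorem PathIndependent.exists_isRanking [Finite X] (hf : PathIndependent f)
    (hX : ∀ x, x ∈ f {x}) {A : Set X} {b : X} (hb : b ∈ f A) (hAY : A ⊆ Y) :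
    ∃ r, IsRanking f Y r ∧ ∀ y ∈ A, r y ≤ r b := by
  induction Y using WellFoundedLT.induction generalizing A b with
  | _ Y ih =>
    by_cases hYA : f Y ⊆ A
    · have hbY : b ∈ f Y := hf.outcast hYA hAY hb
      obtain ⟨r, hr⟩ : ∃ r, IsRanking f (Y \ {b}) r := by
        rcases (Y \ {b}).eq_empty_or_nonempty with hY | ⟨y, hy⟩
        · exact ⟨0, hY ▸ isRanking_empty f 0⟩
        · obtain ⟨r, hr, -⟩ := ih (Y \ {b}) (Set.sdiff_singleton_ssubset.2 (hf.subset Y hbY))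
            (hX y) (Set.singleton_subset_iff.2 hy)
          exact ⟨r, hr⟩
      obtain ⟨r', hr', -, hlt⟩ := hr.exists_extend hbY
      refine ⟨r', hr', fun y hy => ?_⟩
      rcases eq_or_ne y b with rfl | hyb
      · exact le_rfl
      · exact (hlt y ⟨hAY hy, hyb⟩).le
    · obtain ⟨x, hx, hxA⟩ := Set.not_subset.1 hYA
      have hAYx : A ⊆ Y \ {x} := Set.subset_sdiff_singleton hAY hxA
      obtain ⟨r, hr, hle⟩ := ih (Y \ {x}) (Set.sdiff_singleton_ssubset.2 (hf.subset Y hx)) hb hAYx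
      obtain ⟨r', hr', heq, -⟩ := hr.exists_extend hx
      refine ⟨r', hr', fun y hy => ?_⟩
      rw [← heq (hAYx hy), ← heq (hAYx (hf.subset A hb))]
      exact hle y hy

/-- The theorem of Aizerman and Malishevski. -/
theorem PathIndependent.exists_rankings {X : Type u} {f : Set X → Set X} [Finite X]
    (hf : PathIndependent f) (hX : ∀ x, x ∈ f {x}) :
    ∃ (ι : Type u) (_ : Finite ι) (r : ι → X → ℕ), (∀ i, Function.Injective (r i)) ∧
      ∀ A x, x ∈ f A ↔ x ∈ A ∧ ∃ i, ∀ y ∈ A, r i y ≤ r i x := by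
  choose r hr hmax using fun q : {q : Set X × X // q.2 ∈ f q.1} =>
    hf.exists_isRanking hX q.2 (Set.subset_univ _)
  refine ⟨{q : Set X × X // q.2 ∈ f q.1}, inferInstance, r,
    fun i => Set.injOn_univ.1 (hr i).injOn, fun A x => ⟨?_, ?_⟩⟩
  · exact fun hx => ⟨hf.subset A hx, ⟨(A, x), hx⟩, hmax ⟨(A, x), hx⟩⟩
  · rintro ⟨hxA, i, hi⟩
    have hx := (hr i).mem_choice x (Set.mem_univ x)
    refine hf.heritage ?_ hx hxA
    exact fun y hy => ⟨Set.mem_univ y, hi y hy⟩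

theorem PathIndependent.restrict (hf : PathIndependent f) (Y : Set X) :
    PathIndependent fun A : Set Y => Subtype.val ⁻¹' f (Subtype.val '' A) where
  subset A x hx := by simpa using hf.subset _ hx
  heritage hAB hxB hxA := hf.heritage (Set.image_mono hAB) hxB (Set.mem_image_of_mem _ hxA)
  outcast {A B} hBA hAB := by
    refine Set.preimage_mono (hf.outcast (fun x hx => ?_) (Set.image_mono hAB))
    obtain ⟨y, -, rfl⟩ := hf.subset _ hx
    exact ⟨y, hBA hx, rfl⟩

theorem PathIndependent.apply_inter (hf : PathIndependent f) (A : Set X) :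
    f ({x | x ∈ f {x}} ∩ A) = f A := by
  have hsub : f A ⊆ {x | x ∈ f {x}} ∩ A := fun x hx =>
    ⟨hf.heritage (Set.singleton_subset_iff.2 (hf.subset A hx)) hx rfl, hf.subset A hx⟩
  exact (hf.outcast hsub Set.inter_subset_right).antisymm fun x hx =>
    hf.heritage Set.inter_subset_right hx (hsub hx)

end Rankings


/-! ### Points on spokes -/

section Spokes

open scoped RealInnerProductSpace

variable {E ι X : Type*} [NormedAddCommGroup E] [InnerProductSpace ℝ E]
  {u : ι × ℤˣ → E} {ρ : ι → X → ℝ}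

/-- The point labelled `q.2` on the spoke `q.1`, the ray in direction `u q.1`. The spokes `(i, 1)`
and `(i, -1)` form a line, and `ρ i x` is the distance to the origin of both points on this line
that are labelled `x`. -/
def spokePoint (u : ι × ℤˣ → E) (ρ : ι → X → ℝ) (q : (ι × ℤˣ) × X) : E := ρ q.1.1 q.2 • u q.1

/-- Unit vectors `u` and radii `ρ` such that the tangent to the unit circle at `u d` separates the
points on the spoke `d`, which lie outside the circle or on it, from those on all other spokes. -/
structure IsSpokeArrangement (u : ι × ℤˣ → E) (ρ : ι → X → ℝ) : Prop where
  norm_eq_one : ∀ d, ‖u d‖ = 1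
  neg : ∀ i s, u (i, -s) = -u (i, s)
  one_le : ∀ i x, 1 ≤ ρ i x
  mul_inner_lt_one : ∀ d e x, d ≠ e → ρ e.1 x * ⟪u d, u e⟫ < 1

namespace IsSpokeArrangement

theorem inner_spokePoint_self (h : IsSpokeArrangement u ρ) (d : ι × ℤˣ) (x : X) :
    ⟪u d, spokePoint u ρ (d, x)⟫ = ρ d.1 x := by
  rw [spokePoint, real_inner_smul_right, real_inner_self_eq_norm_sq, h.norm_eq_one, one_pow,
    mul_one]

theorem inner_spokePoint_lt_one (h : IsSpokeArrangement u ρ) {d e : ι × ℤˣ} (hde : d ≠ e) (x : X) :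
    ⟪u d, spokePoint u ρ (e, x)⟫ < 1 := by
  rw [spokePoint, real_inner_smul_right]
  exact h.mul_inner_lt_one d e x hde

theorem injective_spokePoint (h : IsSpokeArrangement u ρ) (hρ : ∀ i, Function.Injective (ρ i)) :
    Function.Injective (spokePoint u ρ) := by
  rintro ⟨d, x⟩ ⟨e, y⟩ hxy
  obtain rfl : d = e := by
    by_contra hde
    refine ((h.inner_spokePoint_lt_one hde y).trans_le (h.one_le d.1 x)).ne ?_
    rw [← hxy, h.inner_spokePoint_self]
  have hρxy : ρ d.1 x = ρ d.1 y := by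
    rw [← h.inner_spokePoint_self, hxy, h.inner_spokePoint_self]
  rw [hρ d.1 hρxy]

theorem notMem_convexHull (h : IsSpokeArrangement u ρ) {d : ι × ℤˣ} {x : X}
    {S : Set ((ι × ℤˣ) × X)} (hS : ∀ y, (d, y) ∈ S → ρ d.1 y < ρ d.1 x) :
    spokePoint u ρ (d, x) ∉ convexHull ℝ (spokePoint u ρ '' S) := by
  have hhalf : convexHull ℝ (spokePoint u ρ '' S) ⊆ {w | ⟪u d, w⟫ < ρ d.1 x} := by
    refine convexHull_min ?_ (convex_halfSpace_lt (innerₗ E (u d)).isLinear _)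
    rintro _ ⟨⟨e, y⟩, hy, rfl⟩
    rcases eq_or_ne d e with rfl | hde
    · exact (h.inner_spokePoint_self d y).trans_lt (hS y hy)
    · exact (h.inner_spokePoint_lt_one hde y).trans_le (h.one_le d.1 x)
  exact fun hx => (hhalf hx).ne (h.inner_spokePoint_self d x)

theorem spokePoint_mem_segment (h : IsSpokeArrangement u ρ) {d : ι × ℤˣ} {x y : X}
    (hxy : ρ d.1 x ≤ ρ d.1 y) :
    spokePoint u ρ (d, x) ∈
      segment ℝ (spokePoint u ρ (d, y)) (spokePoint u ρ ((d.1, -d.2), y)) := by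
  have hx := h.one_le d.1 x
  have hy : 0 < ρ d.1 y := by linarith
  set c := ρ d.1 x / ρ d.1 y
  have hcy : c * ρ d.1 y = ρ d.1 x := div_mul_cancel₀ _ hy.ne'
  have hc0 : 0 ≤ c := by positivity
  have hc1 : c ≤ 1 := (div_le_one hy).2 hxy
  refine ⟨(1 + c) / 2, (1 - c) / 2, by linarith, by linarith, by ring, ?_⟩
  simp only [spokePoint, h.neg, ← hcy]
  module

theorem spokePoint_notMem_convexHull_iff (h : IsSpokeArrangement u ρ)
    (hρ : ∀ i, Function.Injective (ρ i)) {A : Set X} {q : (ι × ℤˣ) × X} :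
    spokePoint u ρ q ∉ convexHull ℝ (spokePoint u ρ '' {q' | q'.2 ∈ A ∧ q' ≠ q}) ↔
      ∀ y ∈ A, ρ q.1.1 y ≤ ρ q.1.1 q.2 := by
  obtain ⟨d, x⟩ := q
  constructor
  · intro hx y hy
    by_contra! hlt
    have hyx : y ≠ x := by
      rintro rfl
      exact hlt.false
    have hmem : ∀ e, spokePoint u ρ (e, y) ∈
        convexHull ℝ (spokePoint u ρ '' {q' | q'.2 ∈ A ∧ q' ≠ (d, x)}) := fun e =>
      subset_convexHull ℝ _ ⟨(e, y), ⟨hy, fun hq => hyx (congrArg Prod.snd hq)⟩, rfl⟩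
    exact hx ((convex_convexHull ℝ _).segment_subset (hmem _) (hmem _)
      (h.spokePoint_mem_segment hlt.le))
  · intro hx
    refine h.notMem_convexHull fun y hy => (hx y hy.1).lt_of_ne fun hyx => hy.2 ?_
    rw [hρ d.1 hyx]

end IsSpokeArrangement

/-- The line `i` is given the slope `n`, for a natural number `n` that depends on `i`. -/
theorem exists_unit_vectors (ι : Type*) [Countable ι] :
    ∃ u : ι × ℤˣ → Plane, Function.Injective u ∧ (∀ d, ‖u d‖ = 1) ∧
      ∀ i s, u (i, -s) = -u (i, s) := by
  obtain ⟨n, hn⟩ := exists_injective_nat ι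
  let θ : ι → ℝ := fun i => Real.arctan (n i)
  let v : ι → Plane := fun i => !₂[Real.cos (θ i), Real.sin (θ i)]
  have hv0 : ∀ i, 0 < v i 0 := fun i => Real.cos_arctan_pos _
  have hv1 : ∀ i, v i 1 / v i 0 = n i := fun i =>
    (Real.tan_eq_sin_div_cos (θ i)).symm.trans (Real.tan_arctan _)
  have hs : ∀ s : ℤˣ, ((s : ℤ) : ℝ) ≠ 0 := fun s => Int.cast_ne_zero.2 s.ne_zero
  refine ⟨fun d => ((d.2 : ℤ) : ℝ) • v d.1, ?_, fun ⟨i, s⟩ => ?_, fun i s => ?_⟩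
  · rintro ⟨i, s⟩ ⟨j, t⟩ hij
    have hcoord : ∀ k, ((s : ℤ) : ℝ) * v i k = ((t : ℤ) : ℝ) * v j k := fun k =>
      congrArg (fun w : Plane => w k) hij
    obtain rfl : i = j := by
      have hslope : (n i : ℝ) = n j := by
        rw [← hv1, ← hv1, ← mul_div_mul_left _ _ (hs s), hcoord, hcoord,
          mul_div_mul_left _ _ (hs t)]
      exact hn (Nat.cast_injective hslope)
    have hst : ((s : ℤ) : ℝ) = t := mul_right_cancel₀ (hv0 i).ne' (hcoord 0)
    rw [Units.ext (Int.cast_injective hst)]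
  · have hvi : ‖v i‖ = 1 := by
      simp [v, EuclideanSpace.norm_eq, Fin.sum_univ_two]
    rcases Int.units_eq_one_or s with rfl | rfl <;> simp [hvi]
  · simp

theorem exists_isSpokeArrangement {ι X : Type*} [Finite ι] [Finite X] (r : ι → X → ℕ) :
    ∃ (u : ι × ℤˣ → Plane) (ρ : ι → X → ℝ), IsSpokeArrangement u ρ ∧
      ∀ i x y, ρ i x ≤ ρ i y ↔ r i x ≤ r i y := by
  obtain ⟨u, huinj, hu1, huneg⟩ := exists_unit_vectors ι
  obtain ⟨ε, hε0, hε⟩ : ∃ ε : ℝ, 0 < ε ∧ ∀ (d e : ι × ℤˣ) (x : X), d ≠ e →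
      (1 + ε * r e.1 x) * ⟪u d, u e⟫ < 1 := by
    refine (eventually_mem_nhdsWithin.and ?_ : ∀ᶠ ε in nhdsWithin (0 : ℝ) (Set.Ioi 0), _).exists
    simp only [Filter.eventually_all]
    intro d e x hde
    have hinner : (1 + 0 * (r e.1 x : ℝ)) * ⟪u d, u e⟫ < 1 := by
      rw [zero_mul, add_zero, one_mul]
      exact (inner_lt_one_iff_real_of_norm_eq_one (hu1 d) (hu1 e)).2 fun h => hde (huinj h)
    have hcont : Continuous fun ε : ℝ => (1 + ε * r e.1 x) * ⟪u d, u e⟫ := by fun_prop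
    exact nhdsWithin_le_nhds ((hcont.tendsto 0).eventually_lt_const hinner)
  refine ⟨u, fun i x => 1 + ε * r i x, ⟨hu1, huneg, fun i x => ?_, hε⟩, fun i x y => ?_⟩
  · exact le_add_of_nonneg_right (by positivity)
  · rw [add_le_add_iff_left, mul_le_mul_iff_right₀ hε0, Nat.cast_le]

end Spokes

/-! ### Realization in the plane -/

theorem mem_extremePoints_relative_iff {W : Set Plane} {S : Set W} {w : W} :
    w ∈ (standardConvexity.relative W).extremePoints S ↔
      w ∈ S ∧ (w : Plane) ∉ convexHull ℝ (Subtype.val '' (S \ {w})) := by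
  refine and_congr_right fun _ => ⟨?_, fun hw => ?_⟩
  · rintro ⟨_, ⟨C, hC, rfl⟩, hSC, hwC⟩ hw
    exact hwC (convexHull_min (Set.image_subset_iff.2 hSC) hC hw)
  · exact ⟨_, ⟨_, convex_convexHull ℝ _, rfl⟩,
      Set.image_subset_iff.1 (subset_convexHull ℝ _), hw⟩

theorem exists_label_image_extremePoints {J X : Type*} {pt : J → Plane}
    (hpt : Function.Injective pt) (lab : J → X) :
    ∃ l : Set.range pt → X, ∀ A,
      l '' (standardConvexity.relative (Set.range pt)).extremePoints (l ⁻¹' A) =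
        lab '' {q | lab q ∈ A ∧ pt q ∉ convexHull ℝ (pt '' {q' | lab q' ∈ A ∧ q' ≠ q})} := by
  let e := Equiv.ofInjective pt hpt
  refine ⟨lab ∘ e.symm, fun A => ?_⟩
  rw [Set.image_comp, e.symm.image_eq_preimage_symm]
  congr 1
  ext q
  have himage : Subtype.val '' ((lab ∘ e.symm) ⁻¹' A \ {e q}) =
      pt '' {q' | lab q' ∈ A ∧ q' ≠ q} := by
    rw [← e.image_preimage ((lab ∘ e.symm) ⁻¹' A \ {e q}), ← Set.image_comp]
    congr 1
    ext q'
    simp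
  rw [Set.mem_preimage, e.symm_symm, mem_extremePoints_relative_iff, himage]
  simp [e]

theorem PathIndependent.exists_plane_of_forall_mem_singleton {X : Type*} [Finite X]
    {f : Set X → Set X} (hf : PathIndependent f) (hX : ∀ x, x ∈ f {x}) :
    ∃ W : Set Plane, W.Finite ∧ ∃ l : W → X, ∀ A,
      l '' (standardConvexity.relative W).extremePoints (l ⁻¹' A) = f A := by
  obtain ⟨ι, _, r, hr, hfr⟩ := hf.exists_rankings hX
  obtain ⟨u, ρ, h, hρr⟩ := exists_isSpokeArrangement r
  have hρ : ∀ i, Function.Injective (ρ i) := fun i x y hxy =>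
    hr i (((hρr i x y).1 hxy.le).antisymm ((hρr i y x).1 hxy.ge))
  obtain ⟨l, hl⟩ := exists_label_image_extremePoints (h.injective_spokePoint hρ) Prod.snd
  refine ⟨_, Set.finite_range _, l, fun A => (hl A).trans (Set.ext fun x => ?_)⟩
  simp only [h.spokePoint_notMem_convexHull_iff hρ, hρr, hfr]
  constructor
  · rintro ⟨⟨d, x⟩, ⟨hx, hmax⟩, rfl⟩
    exact ⟨hx, d.1, hmax⟩
  · rintro ⟨hx, i, hmax⟩
    exact ⟨((i, 1), x), ⟨hx, hmax⟩, rfl⟩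

theorem PathIndependent.exists_plane {X : Type*} [Finite X] {f : Set X → Set X}
    (hf : PathIndependent f) :
    ∃ W : Set Plane, W.Finite ∧ ∃ l : W → X, ∀ A,
      l '' (standardConvexity.relative W).extremePoints (l ⁻¹' A) = f A := by
  let Y := {x | x ∈ f {x}}
  have hY : ∀ y : Y, y ∈ (Subtype.val ⁻¹' f (Subtype.val '' {y}) : Set Y) := fun y => by
    rw [Set.image_singleton]
    exact y.2
  obtain ⟨W, hW, l, hl⟩ := (hf.restrict Y).exists_plane_of_forall_mem_singleton hY
  refine ⟨W, hW, Subtype.val ∘ l, fun A => ?_⟩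
  rw [Set.image_comp, Set.preimage_comp, hl, Subtype.image_preimage_coe,
    Subtype.image_preimage_coe, hf.apply_inter, Set.inter_eq_right]
  exact hf.apply_inter A ▸ (hf.subset _).trans Set.inter_subset_left

theorem IsPreferential.exists_plane {X : Type*} [Finite X] {N : Set X → Set X → Prop}
    (hN : IsPreferential N) :
    ∃ W : Set Plane, W.Finite ∧ ∃ l : W → X, ∀ A B,
      N A B ↔ (standardConvexity.relative W).Entails (l ⁻¹' A) (l ⁻¹' B) := by
  obtain ⟨W, hW, l, hl⟩ := hN.pathIndependent_choice.exists_plane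
  have : Finite W := hW
  refine ⟨W, hW, l, fun A B => ?_⟩
  rw [hN.iff_choice_subset, ← hl, ConvexGeometry.entails_iff_extremePoints_subset,
    Set.image_subset_iff]

/-! ### Soundness -/

section Soundness

variable {P : Type u} {W : Type v}

namespace Form0

theorem eval_subst (σ : P → Form0 P) (a : P → Prop) (φ : Form0 P) :
    (φ.subst σ).eval a ↔ φ.eval fun p => (σ p).eval a := by
  induction φ with
  | atom p => rfl
  | neg φ ih => exact not_congr ih
  | and φ ψ ihφ ihψ => exact and_congr ihφ ihψ

theorem ext_subst (σ : P → Form0 P) (V : P → Set W) (φ : Form0 P) :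
    (φ.subst σ).ext V = φ.ext fun p => (σ p).ext V := by
  induction φ with
  | atom p => rfl
  | neg φ ih => exact congrArg compl ih
  | and φ ψ ihφ ihψ => exact congrArg₂ (· ∩ ·) ihφ ihψ

theorem mem_ext {V : P → Set W} {φ : Form0 P} {w : W} :
    w ∈ φ.ext V ↔ φ.eval fun p => w ∈ V p := by
  induction φ with
  | atom p => rfl
  | neg φ ih => exact not_congr ih
  | and φ ψ ihφ ihψ => exact and_congr ihφ ihψ

theorem eval_imp {a : P → Prop} {φ ψ : Form0 P} :
    (φ.imp ψ).eval a ↔ (φ.eval a → ψ.eval a) := by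
  simp only [imp, eval, not_and, not_not]

theorem eval_or {a : P → Prop} {φ ψ : Form0 P} : (φ.or ψ).eval a ↔ φ.eval a ∨ ψ.eval a := by
  simp only [Form0.or, eval, not_and_or, not_not]

theorem eval_iff {a : P → Prop} {φ ψ : Form0 P} :
    (φ.iff ψ).eval a ↔ (φ.eval a ↔ ψ.eval a) := by
  simp only [Form0.iff, eval, eval_imp, iff_iff_implies_and_implies]

theorem ext_or (V : P → Set W) (φ ψ : Form0 P) : (φ.or ψ).ext V = φ.ext V ∪ ψ.ext V := by
  simp only [Form0.or, ext, Set.compl_inter, compl_compl]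

theorem ext_subset_ext {φ ψ : Form0 P} (h : (φ.imp ψ).Tautology) (V : P → Set W) :
    φ.ext V ⊆ ψ.ext V :=
  fun _ hw => mem_ext.2 (eval_imp.1 (h _) (mem_ext.1 hw))

theorem ext_congr {φ ψ : Form0 P} (h : (φ.iff ψ).Tautology) (V : P → Set W) :
    φ.ext V = ψ.ext V :=
  (ext_subset_ext (fun a => (h a).1) V).antisymm (ext_subset_ext (fun a => (h a).2) V)

end Form0

theorem Derivable0.tautology {φ : Form0 P} (h : Derivable0 φ) : φ.Tautology := by
  induction h with
  | taut h => exact h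
  | mp _ _ ihφψ ihφ => exact fun a => Form0.eval_imp.1 (ihφψ a) (ihφ a)
  | subst σ _ ih => exact fun a => (Form0.eval_subst σ a _).2 (ih _)

namespace Model

theorem satisfies_imp {M : Model.{u, v} P} {φ ψ : Form1 P} :
    M.Satisfies (φ.imp ψ) ↔ (M.Satisfies φ → M.Satisfies ψ) := by
  simp only [Form1.imp, Satisfies, not_and, not_not]

theorem satisfies_subst1 (M : Model.{u, v} P) (σ : P → Form1 P) (φ : Form0 P) :
    M.Satisfies (φ.subst1 σ) ↔ φ.eval fun p => M.Satisfies (σ p) := by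
  induction φ with
  | atom p => rfl
  | neg φ ih => exact not_congr ih
  | and φ ψ ihφ ihψ => exact and_congr ihφ ihψ

theorem satisfies_subst (G : ConvexGeometry W) (V : P → Set W) (σ : P → Form0 P) (φ : Form1 P) :
    (Model.mk W G V).Satisfies (φ.subst σ) ↔
      (Model.mk W G fun p => (σ p).ext V).Satisfies φ := by
  induction φ with
  | cond α β => simp only [Form1.subst, Satisfies, Form0.ext_subst]
  | neg φ ih => exact not_congr ih
  | and φ ψ ihφ ihψ => exact and_congr ihφ ihψ

end Model

theorem Derivable1.satisfies {φ : Form1 P} (h : Derivable1 φ) (G : ConvexGeometry W)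
    (V : P → Set W) : (Model.mk W G V).Satisfies φ := by
  have hG := G.isPreferential_entails
  induction h generalizing V with
  | id p => exact hG.refl (V p)
  | and p q r => exact Model.satisfies_imp.2 fun h => hG.inter h.1 h.2
  | cm p q r => exact Model.satisfies_imp.2 fun h => hG.cautious_mono h.1 h.2
  | or p q r =>
    refine Model.satisfies_imp.2 fun h => ?_
    simp only [Model.Satisfies, Form0.ext_or]
    exact hG.union h.1 h.2
  | mp _ _ ihφψ ihφ => exact Model.satisfies_imp.1 (ihφψ V) (ihφ V)
  | subst0 σ h => exact (Model.satisfies_subst1 _ σ _).2 (h.tautology _)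
  | subst σ _ ih => exact (Model.satisfies_subst G V σ _).2 (ih _)
  | lle β h =>
    have hext := Form0.ext_congr h.tautology V
    refine ⟨Model.satisfies_imp.2 ?_, Model.satisfies_imp.2 ?_⟩ <;>
      simp only [Model.Satisfies, hext, imp_self]
  | rw α h =>
    exact Model.satisfies_imp.2 fun hα => hG.mono_right hα (Form0.ext_subset_ext h.tautology V)

end Soundness

/-! ### Theories -/

/-- At least three letters, as many as the axioms mention. Uniform substitution can then put
arbitrary formulas in place of those letters. -/
class HasThreeLetters (P : Type*) : Prop where
  exists_distinct : ∃ p q r : P, p ≠ q ∧ p ≠ r ∧ q ≠ r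

instance {P : Type*} [HasThreeLetters P] : Nonempty P := by
  obtain ⟨p, -⟩ := HasThreeLetters.exists_distinct (P := P)
  exact ⟨p⟩

theorem exists_subst (P : Type*) [HasThreeLetters P] {α : Type*} (a b c : α) :
    ∃ (p q r : P) (σ : P → α), σ p = a ∧ σ q = b ∧ σ r = c := by
  classical
  obtain ⟨p, q, r, hpq, hpr, hqr⟩ := HasThreeLetters.exists_distinct (P := P)
  exact ⟨p, q, r, fun s => if s = p then a else if s = q then b else c, if_pos rfl,
    (if_neg hpq.symm).trans (if_pos rfl), (if_neg hpr.symm).trans (if_neg hqr.symm)⟩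

namespace Derivable1

open Form0

variable {P : Type u} [HasThreeLetters P] (φ ψ χ : Form1 P)

theorem imp_self : Derivable1 (φ.imp φ) := by
  obtain ⟨p, -, -, σ, rfl, -, -⟩ := exists_subst P φ φ φ
  exact .subst0 (φ := (atom p).imp (atom p)) σ
    (.taut fun a => by simp only [eval_imp, eval]; tauto)

theorem imp_imp_left : Derivable1 (φ.imp (ψ.imp φ)) := by
  obtain ⟨p, q, -, σ, rfl, rfl, -⟩ := exists_subst P φ ψ φ
  exact .subst0 (φ := (atom p).imp ((atom q).imp (atom p))) σ
    (.taut fun a => by simp only [eval_imp, eval]; tauto)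

theorem imp_distrib : Derivable1 ((φ.imp (ψ.imp χ)).imp ((φ.imp ψ).imp (φ.imp χ))) := by
  obtain ⟨p, q, r, σ, rfl, rfl, rfl⟩ := exists_subst P φ ψ χ
  exact .subst0 (φ := ((atom p).imp ((atom q).imp (atom r))).imp
    (((atom p).imp (atom q)).imp ((atom p).imp (atom r)))) σ
    (.taut fun a => by simp only [eval_imp, eval]; tauto)

theorem imp_neg_imp : Derivable1 (φ.imp (φ.neg.imp ψ)) := by
  obtain ⟨p, q, -, σ, rfl, rfl, -⟩ := exists_subst P φ ψ φ
  exact .subst0 (φ := (atom p).imp ((atom p).neg.imp (atom q))) σ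
    (.taut fun a => by simp only [eval_imp, eval]; tauto)

theorem imp_neg_imp_imp : Derivable1 ((φ.imp ψ).imp ((φ.neg.imp ψ).imp ψ)) := by
  obtain ⟨p, q, -, σ, rfl, rfl, -⟩ := exists_subst P φ ψ φ
  exact .subst0 (φ := ((atom p).imp (atom q)).imp
    (((atom p).neg.imp (atom q)).imp (atom q))) σ
    (.taut fun a => by simp only [eval_imp, eval]; tauto)

theorem and_imp_left : Derivable1 ((φ.and ψ).imp φ) := by
  obtain ⟨p, q, -, σ, rfl, rfl, -⟩ := exists_subst P φ ψ φ
  exact .subst0 (φ := ((atom p).and (atom q)).imp (atom p)) σ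
    (.taut fun a => by simp only [eval_imp, eval]; tauto)

theorem and_imp_right : Derivable1 ((φ.and ψ).imp ψ) := by
  obtain ⟨p, q, -, σ, rfl, rfl, -⟩ := exists_subst P φ ψ φ
  exact .subst0 (φ := ((atom p).and (atom q)).imp (atom q)) σ
    (.taut fun a => by simp only [eval_imp, eval]; tauto)

theorem imp_imp_and : Derivable1 (φ.imp (ψ.imp (φ.and ψ))) := by
  obtain ⟨p, q, -, σ, rfl, rfl, -⟩ := exists_subst P φ ψ φ
  exact .subst0 (φ := (atom p).imp ((atom q).imp ((atom p).and (atom q)))) σ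
    (.taut fun a => by simp only [eval_imp, eval]; tauto)

end Derivable1

/-- A set of one-step formulas that contains what is derivable and is closed under modus ponens. -/
structure IsTheory {P : Type u} (T : Set (Form1 P)) : Prop where
  derivable : ∀ {φ}, Derivable1 φ → φ ∈ T
  mp : ∀ {φ ψ : Form1 P}, φ.imp ψ ∈ T → φ ∈ T → ψ ∈ T

/-- A consistent theory that decides every one-step formula. -/
structure IsCompleteTheory {P : Type u} (T : Set (Form1 P)) : Prop extends IsTheory T where
  neg_mem_iff : ∀ {φ : Form1 P}, φ.neg ∈ T ↔ φ ∉ T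

section Theories

variable {P : Type u} {T : Set (Form1 P)}

theorem isTheory_sUnion {c : Set (Set (Form1 P))} (hc : ∀ T ∈ c, IsTheory T)
    (hchain : IsChain (· ⊆ ·) c) (hne : c.Nonempty) : IsTheory (⋃₀ c) where
  derivable hφ := by
    obtain ⟨T, hT⟩ := hne
    exact ⟨T, hT, (hc T hT).derivable hφ⟩
  mp := by
    rintro φ ψ ⟨T, hT, hφψ⟩ ⟨U, hU, hφ⟩
    rcases hchain.total hT hU with hTU | hUT
    · exact ⟨U, hU, (hc U hU).mp (hTU hφψ) hφ⟩
    · exact ⟨T, hT, (hc T hT).mp hφψ (hUT hφ)⟩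

theorem IsTheory.cond_self_mem [Nonempty P] (hT : IsTheory T) (α : Form0 P) : .cond α α ∈ T :=
  hT.derivable (.subst (fun _ => α) (.id (Classical.arbitrary P)))

theorem exists_maximal_isTheory_notMem {φ : Form1 P} (hφ : ¬ Derivable1 φ) :
    ∃ T, Maximal (fun T => IsTheory T ∧ φ ∉ T) T := by
  obtain ⟨T, -, hT⟩ := zorn_subset_nonempty {T : Set (Form1 P) | IsTheory T ∧ φ ∉ T}
    (fun c hc hchain hne => ⟨⋃₀ c, ⟨isTheory_sUnion (fun T hT => (hc hT).1) hchain hne,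
      fun ⟨T, hT, hφT⟩ => (hc hT).2 hφT⟩, fun T hT => Set.subset_sUnion_of_mem hT⟩)
    {ψ | Derivable1 ψ} ⟨⟨id, .mp⟩, hφ⟩
  exact ⟨T, hT⟩

variable [HasThreeLetters P]

theorem IsTheory.imp_mem_of_mem (hT : IsTheory T) (φ : Form1 P) {ψ : Form1 P} (hψ : ψ ∈ T) :
    φ.imp ψ ∈ T :=
  hT.mp (hT.derivable (.imp_imp_left ψ φ)) hψ

theorem IsTheory.setOf_imp_mem (hT : IsTheory T) (φ : Form1 P) : IsTheory {ψ | φ.imp ψ ∈ T} where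
  derivable hψ := hT.imp_mem_of_mem φ (hT.derivable hψ)
  mp hψχ hψ := hT.mp (hT.mp (hT.derivable (.imp_distrib φ _ _)) hψχ) hψ

/-- For `ψ ∉ T` the theory `{χ | ψ → χ ∈ T}` is strictly larger than `T`, so it contains `φ`. -/
theorem isCompleteTheory_of_maximal {φ : Form1 P}
    (hT : Maximal (fun T => IsTheory T ∧ φ ∉ T) T) : IsCompleteTheory T where
  toIsTheory := hT.prop.1
  neg_mem_iff {ψ} := by
    obtain ⟨⟨hth, hφ⟩, hmax⟩ := hT
    have himp : ∀ ψ, ψ ∉ T → ψ.imp φ ∈ T := fun ψ hψ => by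
      by_contra hψφ
      exact hψ (hmax ⟨hth.setOf_imp_mem ψ, hψφ⟩ (fun χ hχ => hth.imp_mem_of_mem ψ hχ)
        (hth.derivable (.imp_self ψ)))
    refine ⟨fun hneg hψ => hφ ?_, fun hψ => by_contra fun hneg => hφ ?_⟩
    · exact hth.mp (hth.mp (hth.derivable (.imp_neg_imp ψ φ)) hψ) hneg
    · exact hth.mp (hth.mp (hth.derivable (.imp_neg_imp_imp ψ φ)) (himp ψ hψ)) (himp ψ.neg hneg)

theorem exists_isCompleteTheory_notMem {φ : Form1 P} (hφ : ¬ Derivable1 φ) :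
    ∃ T, IsCompleteTheory T ∧ φ ∉ T := by
  obtain ⟨T, hT⟩ := exists_maximal_isTheory_notMem hφ
  exact ⟨T, isCompleteTheory_of_maximal hT, hT.prop.2⟩

namespace IsTheory

variable {α α' β β' γ : Form0 P}

theorem and_mem_iff (hT : IsTheory T) {φ ψ : Form1 P} : φ.and ψ ∈ T ↔ φ ∈ T ∧ ψ ∈ T :=
  ⟨fun h => ⟨hT.mp (hT.derivable (.and_imp_left φ ψ)) h,
    hT.mp (hT.derivable (.and_imp_right φ ψ)) h⟩,
    fun h => hT.mp (hT.mp (hT.derivable (.imp_imp_and φ ψ)) h.1) h.2⟩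

theorem cond_and_mem (hT : IsTheory T) (hβ : .cond α β ∈ T) (hγ : .cond α γ ∈ T) :
    .cond α (β.and γ) ∈ T := by
  obtain ⟨p, q, r, σ, rfl, rfl, rfl⟩ := exists_subst P α β γ
  exact hT.mp (hT.derivable (.subst σ (.and p q r))) (hT.and_mem_iff.2 ⟨hβ, hγ⟩)

theorem and_cond_mem (hT : IsTheory T) (hβ : .cond α β ∈ T) (hγ : .cond α γ ∈ T) :
    .cond (α.and γ) β ∈ T := by
  obtain ⟨p, q, r, σ, rfl, rfl, rfl⟩ := exists_subst P α β γ
  exact hT.mp (hT.derivable (.subst σ (.cm p q r))) (hT.and_mem_iff.2 ⟨hβ, hγ⟩)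

theorem or_cond_mem (hT : IsTheory T) (hα : .cond α β ∈ T) (hγ : .cond γ β ∈ T) :
    .cond (α.or γ) β ∈ T := by
  obtain ⟨p, q, r, σ, rfl, rfl, rfl⟩ := exists_subst P α β γ
  exact hT.mp (hT.derivable (.subst σ (.or p q r))) (hT.and_mem_iff.2 ⟨hα, hγ⟩)

theorem cond_mem_mono (hT : IsTheory T) (hα : ∀ a, α.eval a ↔ α'.eval a)
    (hβ : ∀ a, β.eval a → β'.eval a) (h : .cond α β ∈ T) : .cond α' β' ∈ T := by
  have hαα' := hT.derivable (.lle β' (.taut fun a => Form0.eval_iff.2 (hα a)))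
  have hββ' := hT.derivable (.rw α (.taut fun a => Form0.eval_imp.2 (hβ a)))
  exact hT.mp (hT.and_mem_iff.1 hαα').1 (hT.mp hββ' h)

end IsTheory

end Theories

/-! ### Completeness -/

section Definability

variable {P : Type u}

/-- The letters that occur in a propositional formula. -/
def Form0.letters : Form0 P → Set P
  | .atom p => {p}
  | .neg φ => φ.letters
  | .and φ ψ => φ.letters ∪ ψ.letters

/-- The letters that occur in a one-step formula. -/
def Form1.letters : Form1 P → Set P
  | .cond α β => α.letters ∪ β.letters
  | .neg φ => φ.letters
  | .and φ ψ => φ.letters ∪ ψ.letters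

theorem Form0.finite_letters (φ : Form0 P) : φ.letters.Finite := by
  induction φ with
  | atom p => exact Set.finite_singleton p
  | neg _ ih => exact ih
  | and _ _ ihφ ihψ => exact ihφ.union ihψ

theorem Form1.finite_letters (φ : Form1 P) : φ.letters.Finite := by
  induction φ with
  | cond α β => exact α.finite_letters.union β.finite_letters
  | neg _ ih => exact ih
  | and _ _ ihφ ihψ => exact ihφ.union ihψ

variable {S : Set P} {α β : Form0 P} {A B : Set (S → Prop)}

/-- The formula `α` defines the set `A` of truth assignments to the letters in `S`; in particular,
its truth value depends on these letters only, though others may occur in it. -/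
def Form0.Defines (α : Form0 P) (A : Set (S → Prop)) : Prop :=
  ∀ a : P → Prop, α.eval a ↔ S.domRestrict a ∈ A

theorem Form0.Defines.neg (hα : α.Defines A) : α.neg.Defines Aᶜ :=
  fun a => not_congr (hα a)

theorem Form0.Defines.and (hα : α.Defines A) (hβ : β.Defines B) : (α.and β).Defines (A ∩ B) :=
  fun a => and_congr (hα a) (hβ a)

theorem Form0.Defines.or (hα : α.Defines A) (hβ : β.Defines B) : (α.or β).Defines (A ∪ B) :=
  fun a => Form0.eval_or.trans (or_congr (hα a) (hβ a))

theorem Form0.Defines.eval_of_eval (hα : α.Defines A) (hβ : β.Defines B) (hAB : A ⊆ B)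
    (a : P → Prop) (h : α.eval a) : β.eval a :=
  (hβ a).2 (hAB ((hα a).1 h))

/-- The sets of truth assignments to the letters in `S` that are defined by formulas. -/
def definableSets (S : Set P) [Nonempty P] : BooleanSubalgebra (Set (S → Prop)) where
  carrier := {A | ∃ α : Form0 P, α.Defines A}
  supClosed' := by
    rintro A ⟨α, hα⟩ B ⟨β, hβ⟩
    exact ⟨α.or β, hα.or hβ⟩
  infClosed' := by
    rintro A ⟨α, hα⟩ B ⟨β, hβ⟩
    exact ⟨α.and β, hα.and hβ⟩
  compl_mem' := by
    rintro A ⟨α, hα⟩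
    exact ⟨α.neg, hα.neg⟩
  bot_mem' := by
    obtain ⟨p⟩ := ‹Nonempty P›
    exact ⟨(Form0.atom p).and (Form0.atom p).neg, fun a => iff_of_false (fun h => h.2 h.1) id⟩

theorem exists_defines [Finite S] [Nonempty P] (A : Set (S → Prop)) :
    ∃ α : Form0 P, α.Defines A := by
  have hliteral : ∀ (x : S → Prop) (p : S), {y : S → Prop | y p ↔ x p} ∈ definableSets S := by
    intro x p
    by_cases hp : x p
    · exact ⟨.atom p, fun a => (iff_true_right hp).symm⟩
    · exact ⟨(Form0.atom (p : P)).neg, fun a => (iff_false_right hp).symm⟩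
  have hA : A = ⨆ x ∈ A, ⨅ p, {y : S → Prop | y p ↔ x p} := by
    ext y
    simp only [Set.iSup_eq_iUnion, Set.iInf_eq_iInter, Set.mem_iUnion, Set.mem_iInter,
      Set.mem_ofPred_eq, exists_prop]
    refine ⟨fun hy => ⟨y, hy, fun p => Iff.rfl⟩, ?_⟩
    rintro ⟨x, hx, hyx⟩
    rwa [show y = x from funext fun p => propext (hyx p)]
  change A ∈ definableSets S
  rw [hA]
  exact BooleanSubalgebra.biSup_mem A.toFinite fun x _ =>
    BooleanSubalgebra.iInf_mem fun p => hliteral x p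

/-- The valuation whose worlds are the truth assignments to the letters in `S`; the other letters
are false. -/
def canonicalVal (S : Set P) (p : P) : Set (S → Prop) := {x | ∃ hp : p ∈ S, x ⟨p, hp⟩}

theorem Form0.defines_ext_canonicalVal (hα : α.letters ⊆ S) :
    α.Defines (α.ext (canonicalVal S)) := by
  induction α with
  | atom p => exact fun a => ⟨fun ha => ⟨hα rfl, ha⟩, fun ⟨_, ha⟩ => ha⟩
  | neg α ih => exact (ih hα).neg
  | and α β ihα ihβ =>
    obtain ⟨hα, hβ⟩ := Set.union_subset_iff.1 hα
    exact (ihα hα).and (ihβ hβ)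

end Definability

theorem Form0.ext_preimage {P : Type u} {X W : Type*} (l : W → X) (V : P → Set X) (α : Form0 P) :
    α.ext (fun p => l ⁻¹' V p) = l ⁻¹' α.ext V := by
  ext w
  rw [Form0.mem_ext, Set.mem_preimage, Form0.mem_ext]
  rfl

section Completeness

variable {P : Type u} [HasThreeLetters P] {T : Set (Form1 P)} {S : Set P}

/-- The consequence relation that a theory induces on the definable sets of truth assignments to
the letters in `S`. -/
def consequence (T : Set (Form1 P)) (A B : Set (S → Prop)) : Prop :=
  ∃ α β : Form0 P, α.Defines A ∧ β.Defines B ∧ .cond α β ∈ T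

theorem IsTheory.consequence_iff (hT : IsTheory T) {α β : Form0 P} {A B : Set (S → Prop)}
    (hα : α.Defines A) (hβ : β.Defines B) : consequence T A B ↔ .cond α β ∈ T := by
  refine ⟨?_, fun h => ⟨α, β, hα, hβ, h⟩⟩
  rintro ⟨α', β', hα', hβ', h⟩
  exact hT.cond_mem_mono (fun a => (hα' a).trans (hα a).symm) (hβ'.eval_of_eval hβ subset_rfl) h

theorem IsTheory.isPreferential_consequence [Finite S] (hT : IsTheory T) :
    IsPreferential (consequence T : Set (S → Prop) → Set (S → Prop) → Prop) where
  refl A := by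
    obtain ⟨α, hα⟩ := exists_defines A
    exact ⟨α, α, hα, hα, hT.cond_self_mem α⟩
  mono_right {A B C} := by
    rintro ⟨α, β, hα, hβ, h⟩ hBC
    obtain ⟨γ, hγ⟩ := exists_defines C
    exact ⟨α, γ, hα, hγ,
      hT.cond_mem_mono (fun _ => Iff.rfl) (hβ.eval_of_eval hγ hBC) h⟩
  inter := by
    rintro A B C ⟨α, β, hα, hβ, hAB⟩ hAC
    obtain ⟨γ, hγ⟩ := exists_defines C
    exact ⟨α, _, hα, hβ.and hγ, hT.cond_and_mem hAB ((hT.consequence_iff hα hγ).1 hAC)⟩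
  cautious_mono := by
    rintro A B C ⟨α, β, hα, hβ, hAB⟩ hAC
    obtain ⟨γ, hγ⟩ := exists_defines C
    exact ⟨_, β, hα.and hγ, hβ, hT.and_cond_mem hAB ((hT.consequence_iff hα hγ).1 hAC)⟩
  union := by
    rintro A B C ⟨α, β, hα, hβ, hAB⟩ hCB
    obtain ⟨γ, hγ⟩ := exists_defines C
    exact ⟨_, β, hα.or hγ, hβ, hT.or_cond_mem hAB ((hT.consequence_iff hγ hβ).1 hCB)⟩

theorem IsCompleteTheory.satisfies_iff_mem (hT : IsCompleteTheory T) {W : Type v}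
    {G : ConvexGeometry W} {l : W → S → Prop}
    (hl : ∀ A B, consequence T A B ↔ G.Entails (l ⁻¹' A) (l ⁻¹' B)) {φ : Form1 P}
    (hφ : φ.letters ⊆ S) :
    (Model.mk W G fun p => l ⁻¹' canonicalVal S p).Satisfies φ ↔ φ ∈ T := by
  induction φ with
  | cond α β =>
    obtain ⟨hα, hβ⟩ := Set.union_subset_iff.1 hφ
    change G.Entails (α.ext _) (β.ext _) ↔ _
    rw [Form0.ext_preimage, Form0.ext_preimage, ← hl]
    exact hT.consequence_iff (Form0.defines_ext_canonicalVal hα)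
      (Form0.defines_ext_canonicalVal hβ)
  | neg φ ih => exact (not_congr (ih hφ)).trans hT.neg_mem_iff.symm
  | and φ ψ ihφ ihψ =>
    obtain ⟨hφ, hψ⟩ := Set.union_subset_iff.1 hφ
    exact (and_congr (ihφ hφ) (ihψ hψ)).trans hT.and_mem_iff.symm

theorem exists_planeModel_not_satisfies {φ : Form1 P} (hφ : ¬ Derivable1 φ) :
    ∃ W : Set Plane, W.Finite ∧ ∃ V : P → Set W, ¬ (planeModel W V).Satisfies φ := by
  obtain ⟨T, hT, hφT⟩ := exists_isCompleteTheory_notMem hφ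
  have : Finite φ.letters := φ.finite_letters
  obtain ⟨W, hW, l, hl⟩ := (hT.isPreferential_consequence (S := φ.letters)).exists_plane
  exact ⟨W, hW, _, fun h => hφT ((hT.satisfies_iff_mem hl subset_rfl).1 h)⟩

end Completeness

end PCL

theorem mainTheorem1 {P : Type*} (hP : ∃ p q r : P, p ≠ q ∧ p ≠ r ∧ q ≠ r) :
    (∀ φ : PCL.Form1 P, PCL.Consistent φ →
      ∃ W : Set PCL.Plane, W.Finite ∧ ∃ V : P → Set W, (PCL.planeModel W V).Satisfies φ) ∧
    (∀ φ : PCL.Form1 P, PCL.Derivable1 φ ↔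
      ∀ W : Set PCL.Plane, W.Finite → ∀ V : P → Set W, (PCL.planeModel W V).Satisfies φ) := by
  have : PCL.HasThreeLetters P := ⟨hP⟩
  refine ⟨fun φ hφ => ?_, fun φ => ⟨fun h W _ V => h.satisfies _ V, fun h => ?_⟩⟩
  · obtain ⟨W, hW, V, hV⟩ := PCL.exists_planeModel_not_satisfies hφ
    exact ⟨W, hW, V, not_not.1 hV⟩
  · by_contra hφ
    obtain ⟨W, hW, V, hV⟩ := PCL.exists_planeModel_not_satisfies hφ
    exact hV (h W hW V)
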